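/- Let $\mathbb{R}^{2,n}$ be $\mathbb{R}^{n+2}$ with the bilinear form $\langle\cdot|\cdot\rangle$ of signature $(2,n)$, let $\mathrm{Ein}_n$ be the space of rays of its null cone (a manifold of dimension $n$, on which the identity component $\mathrm{SO}_0(2,n)$ of $\mathrm{O}(2,n)$ acts), and let $\mathcal{Y}\subset \mathrm{Ein}_n\times\mathrm{Ein}_n$ be the set of pairs $(x,y)$ of points that are not causally related, i.e. $\langle x|y\rangle<0$. Let $\widetilde N$ be a locally compact Hausdorff space with a continuous flow $\tilde\Phi^t$, let $\Gamma$ be a group acting on $\widetilde N$ properly discontinuously, by homeomorphisms commuting with $\tilde\Phi^t$, and with compact quotient $N=\Gamma\backslash\widetilde N$ (for instance: $\Gamma$ a cocompact lattice in $\mathrm{SO}_0(1,n)$ and $\tilde\Phi^t$ the geodesic flow on $\widetilde N=\mathrm{T}^1\mathbb{H}^n$). Let $\rho:\Gamma\to\mathrm{SO}_0(2,n)$ be a representation. By a parallel section we mean a continuous $\Gamma$-equivariant map $\ell:\widetilde N\to\mathrm{Ein}_n$ with $\ell(\tilde\Phi^t(p))=\ell(p)$ for all $p$ and $t$. Call $\rho$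 $(\mathrm{SO}_0(2,n),\mathcal{Y})$-Anosov if there are parallel sections $\ell^+,\ell^-$ with $(\ell^+(p),\ell^-(p))\in\mathcal{Y}$ for all $p$, continuous $\Gamma$-equivariant families of Euclidean metrics $g_\pm^p$ on $\mathrm{T}_{\ell^\pm(p)}\mathrm{Ein}_n$ ($p\in\widetilde N$), and constants $a,b>0$ such that, for all $p\in\widetilde N$ and $t\ge 0$, $$g_+^{\tilde\Phi^t(p)}(w,w)\ \ge\ a\,e^{bt}\,g_+^p(w,w)\quad (w\in \mathrm{T}_{\ell^+(p)}\mathrm{Ein}_n),\qquad g_-^{\tilde\Phi^t(p)}(w,w)\ \le\ a^{-1}e^{-bt}\,g_-^p(w,w)\quad (w\in \mathrm{T}_{\ell^-(p)}\mathrm{Ein}_n).$$ **Proposition.** Assume that there are parallel sections $\ell_\rho^+,\ell_\rho^-:\widetilde N\to\mathrm{Ein}_n$ and continuous $\Gamma$-equivariant families of Riemannian metrics $g_+^p$, $g_-^p$ ($p\in\widetilde N$), defined in a neighborhood of $\ell_\rho^+(p)$, respectively of $\ell_\rho^-(p)$, in $\mathrm{Ein}_n$ (for instance the restrictions of one family $g^p$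 defined near both points), such that for every $p\in\widetilde N$: - there is $t>0$ with $g_+^{\tilde\Phi^t(p)}(w,w)\ge 2\,g_+^p(w,w)$ for all $w\in\mathrm{T}_{\ell_\rho^+(p)}\mathrm{Ein}_n$; - there is $t>0$ with $g_-^{\tilde\Phi^t(p)}(w,w)\le \tfrac12\,g_-^p(w,w)$ for all $w\in\mathrm{T}_{\ell_\rho^-(p)}\mathrm{Ein}_n$. Then $\rho$ is $(\mathrm{SO}_0(2,n),\mathcal{Y})$-Anosov. -/

import Mathlib

open Topology

noncomputable section

namespace EinAnosov

/-- The vector space `ℝ^{2,n}`, with its auxiliary Euclidean norm; the two coordinates indexed by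
`Fin 2` are the negative ones. -/
abbrev R2 (n : ℕ) : Type := EuclideanSpace ℝ (Fin 2 ⊕ Fin n)

/-- The symmetric bilinear form of signature `(2,n)` on `ℝ^{2,n}`. -/
def sca {n : ℕ} (v w : R2 n) : ℝ :=
  (∑ j : Fin n, v (Sum.inr j) * w (Sum.inr j)) - ∑ i : Fin 2, v (Sum.inl i) * w (Sum.inl i)

theorem sca_add_right {n : ℕ} (v w w' : R2 n) : sca v (w + w') = sca v w + sca v w' := by
  simp only [sca, PiLp.add_apply, mul_add, Finset.sum_add_distrib]
  ring

theorem sca_smul_right {n : ℕ} (c : ℝ) (v w : R2 n) : sca v (c • w) = c * sca v w := by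
  simp only [sca, PiLp.smul_apply, smul_eq_mul, mul_sub, Finset.mul_sum]
  congr 1 <;> exact Finset.sum_congr rfl fun _ _ => by ring

theorem sca_comm {n : ℕ} (v w : R2 n) : sca v w = sca w v := by
  simp only [sca, mul_comm]

theorem sca_smul_left {n : ℕ} (c : ℝ) (v w : R2 n) : sca (c • v) w = c * sca v w := by
  rw [sca_comm, sca_smul_right, sca_comm]

/-- The group `O(2,n)` of linear automorphisms of `ℝ^{2,n}` preserving the form. -/
def O2 (n : ℕ) : Subgroup (R2 n →L[ℝ] R2 n)ˣ where
  carrier := {A | ∀ v w, sca (A.1 v) (A.1 w) = sca v w}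
  one_mem' := fun _ _ => rfl
  mul_mem' := fun {A B} hA hB v w => by
    change sca (A.1 (B.1 v)) (A.1 (B.1 w)) = sca v w
    rw [hA, hB]
  inv_mem' := fun {A} hA v w => by
    have key : ∀ u, A.1 ((A⁻¹).1 u) = u := fun u => by
      change (A.1 * (A⁻¹).1) u = u
      rw [Units.mul_inv]; rfl
    rw [← hA, key, key]

/-- `SO₀(2,n)`: the identity component of `O(2,n)`. -/
def SO2 (n : ℕ) : Subgroup (O2 n) := Subgroup.connectedComponentOfOne (O2 n)

/-- The Einstein universe `Ein_n` (of dimension `n`, doubly covering its image in projective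
space): the space of rays of the null cone of `ℝ^{2,n}`, each ray being represented by its point on
the Euclidean unit sphere. -/
def Ein (n : ℕ) : Type := {v : R2 n // ‖v‖ = 1 ∧ sca v v = 0}

instance (n : ℕ) : TopologicalSpace (Ein n) :=
  inferInstanceAs (TopologicalSpace {v : R2 n // ‖v‖ = 1 ∧ sca v v = 0})

/-- The action of a linear map on rays, in terms of unit vectors: `z ↦ A z / ‖A z‖`. -/
def radial {n : ℕ} (A : O2 n) (z : R2 n) : R2 n := ‖A.1.1 z‖⁻¹ • A.1.1 z

theorem apply_ne_zero {n : ℕ} (A : O2 n) {z : R2 n} (hz : z ≠ 0) : A.1.1 z ≠ 0 := by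
  intro h
  apply hz
  have : ((A.1⁻¹).1 * A.1.1) z = 0 := by
    change (A.1⁻¹).1 (A.1.1 z) = 0
    rw [h, map_zero]
  rwa [Units.inv_mul] at this

theorem Ein.ne_zero {n : ℕ} (x : Ein n) : x.1 ≠ 0 := by
  intro h
  have := x.2.1
  rw [h, norm_zero] at this
  exact zero_ne_one this

theorem norm_radial {n : ℕ} (A : O2 n) {z : R2 n} (hz : z ≠ 0) : ‖radial A z‖ = 1 := by
  rw [radial, norm_smul, norm_inv, norm_norm]
  exact inv_mul_cancel₀ (norm_ne_zero_iff.2 (apply_ne_zero A hz))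

/-- The action of `O(2,n)`, hence of `SO₀(2,n)`, on `Ein_n`. -/
instance (n : ℕ) : MulAction (O2 n) (Ein n) where
  smul A x := ⟨radial A x.1, norm_radial A x.ne_zero, by
    rw [radial, sca_smul_left, sca_smul_right, A.2, x.2.2, mul_zero, mul_zero]⟩
  one_smul x := Subtype.ext (by
    change ‖x.1‖⁻¹ • x.1 = x.1
    rw [x.2.1, inv_one, one_smul])
  mul_smul A B x := Subtype.ext (by
    change ‖A.1.1 (B.1.1 x.1)‖⁻¹ • A.1.1 (B.1.1 x.1) =
      ‖A.1.1 (‖B.1.1 x.1‖⁻¹ • B.1.1 x.1)‖⁻¹ • A.1.1 (‖B.1.1 x.1‖⁻¹ • B.1.1 x.1)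
    have h : ‖B.1.1 x.1‖ ≠ 0 := norm_ne_zero_iff.2 (apply_ne_zero B x.ne_zero)
    rw [map_smul, norm_smul, norm_inv, norm_norm, smul_smul, mul_inv, inv_inv, mul_right_comm,
      mul_inv_cancel₀ h, one_mul])

/-- The tangent space of `Ein_n` at `x`, as a subspace of `ℝ^{2,n}`: the kernel of the
differentials at `x` of the two equations defining `Ein_n`. -/
def tangent {n : ℕ} (x : Ein n) : Submodule ℝ (R2 n) where
  carrier := {w | inner ℝ x.1 w = 0 ∧ sca x.1 w = 0}
  zero_mem' := by simp [sca]
  add_mem' := fun {v w} hv hw => by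
    refine ⟨?_, ?_⟩
    · rw [inner_add_right, hv.1, hw.1, add_zero]
    · rw [sca_add_right, hv.2, hw.2, add_zero]
  smul_mem' := fun c w hw => by
    refine ⟨?_, ?_⟩
    · rw [inner_smul_right, hw.1, mul_zero]
    · rw [sca_smul_right, hw.2, mul_zero]

theorem fderiv_radial_mem {n : ℕ} (A : O2 n) (x : Ein n) (w : tangent x) :
    fderiv ℝ (radial A) x.1 w.1 ∈ tangent (A • x) := by
  have h0 : A.1.1 x.1 ≠ 0 := apply_ne_zero A x.ne_zero
  have hA : DifferentiableAt ℝ (fun z => A.1.1 z) x.1 := A.1.1.differentiableAt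
  have hc : DifferentiableAt ℝ (fun z => ‖A.1.1 z‖⁻¹) x.1 :=
    (hA.norm ℝ h0).inv (norm_ne_zero_iff.2 h0)
  have hF : DifferentiableAt ℝ (radial A) x.1 := hc.smul hA
  refine ⟨?_, ?_⟩
  · change inner ℝ (radial A x.1) (fderiv ℝ (radial A) x.1 w.1) = 0
    have hev : (fun z => ‖radial A z‖ ^ 2) =ᶠ[𝓝 x.1] fun _ => (1 : ℝ) := by
      filter_upwards [isOpen_ne.mem_nhds x.ne_zero] with z hz
      rw [norm_radial A hz, one_pow]
    have h1 := hF.hasFDerivAt.norm_sq.unique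
      ((hasFDerivAt_const (1 : ℝ) x.1).congr_of_eventuallyEq hev)
    have h2 := congrArg (fun L : R2 n →L[ℝ] ℝ => L w.1) h1
    simpa using h2
  · change sca (radial A x.1) (fderiv ℝ (radial A) x.1 w.1) = 0
    have h1 : fderiv ℝ (radial A) x.1 = _ :=
      (hc.hasFDerivAt.smul (A.1.1.hasFDerivAt (x := x.1))).fderiv
    rw [h1]
    simp only [add_apply, smul_apply,
      ContinuousLinearMap.smulRight_apply, radial, sca_smul_left, sca_add_right, sca_smul_right]
    rw [A.2, A.2, w.2.2, x.2.2]
    ring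

/-- The differential at `x` of the action of `A` on `Ein_n`. -/
def dAct {n : ℕ} (A : O2 n) (x : Ein n) : tangent x →ₗ[ℝ] tangent (A • x) where
  toFun w := ⟨fderiv ℝ (radial A) x.1 w.1, fderiv_radial_mem A x w⟩
  map_add' v w := Subtype.ext (by simp)
  map_smul' c w := Subtype.ext (by simp)

/-- The space `𝒴` of pairs of points of `Ein_n` that are not causally related. -/
def Y (n : ℕ) : Set (Ein n × Ein n) := {z | sca z.1.1 z.2.1 < 0}

/-- The total space of the tangent bundle of `Ein_n`. -/
def TEin (n : ℕ) : Type := {z : Ein n × R2 n // z.2 ∈ tangent z.1}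

instance (n : ℕ) : TopologicalSpace (TEin n) :=
  inferInstanceAs (TopologicalSpace {z : Ein n × R2 n // z.2 ∈ tangent z.1})

/-- A continuous `Γ`-equivariant family of metrics `g^p`, `p ∈ M`, where `g^p` is a positive
definite symmetric bilinear form on `T_x Ein_n` for each `x` with `(p, x)` in the set `dom`.
The values of `g` outside of `dom` are irrelevant. -/
structure MetricFamily {n : ℕ} {Γ M : Type*} [Group Γ] [MulAction Γ M] [TopologicalSpace M]
    (ρ : Γ →* SO2 n) where
  dom : Set (M × Ein n)
  smul_mem : ∀ (γ : Γ) (p : M) (x : Ein n), (p, x) ∈ dom → (γ • p, (ρ γ : O2 n) • x) ∈ dom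
  g : M → (x : Ein n) → LinearMap.BilinForm ℝ (tangent x)
  symm : ∀ p x, (p, x) ∈ dom → ∀ v w, g p x v w = g p x w v
  pos : ∀ p x, (p, x) ∈ dom → ∀ w, w ≠ 0 → 0 < g p x w w
  cont : ContinuousOn
    (fun z : M × TEin n => g z.1 z.2.1.1 ⟨z.2.1.2, z.2.2⟩ ⟨z.2.1.2, z.2.2⟩)
    {z | (z.1, z.2.1.1) ∈ dom}
  equivariant : ∀ (γ : Γ) (p : M) (x : Ein n), (p, x) ∈ dom → ∀ v w,
    g (γ • p) ((ρ γ : O2 n) • x) (dAct (ρ γ) x v) (dAct (ρ γ) x w) = g p x v w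

/-- A continuous `Γ`-equivariant map `M → Ein_n` that is constant along the orbits of the flow,
i.e. a continuous section, parallel along the flow, of the flat `Ein_n`-bundle over `Γ \ M`
associated to `ρ`. -/
structure IsParallelSection {n : ℕ} {Γ M : Type*} [Group Γ] [MulAction Γ M] [TopologicalSpace M]
    (Φ : Flow ℝ M) (ρ : Γ →* SO2 n) (l : M → Ein n) : Prop where
  continuous : Continuous l
  equivariant : ∀ (γ : Γ) (p : M), l (γ • p) = (ρ γ : O2 n) • l p
  flow_invariant : ∀ (t : ℝ) (p : M), l (Φ t p) = l p

/-- `ρ` is `(SO₀(2,n), 𝒴)`-Anosov, with respect to the lift `Φ` to `M` of a flow on `Γ \ M`: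
the flat `𝒴`-bundle over `Γ \ M` has a continuous section `(l⁺, l⁻)`, parallel along the flow, such
that the lifted flow expands the vertical tangent bundle along `l⁺` and contracts the one along
`l⁻`, exponentially for some continuous `Γ`-invariant metrics on these vector bundles. -/
def IsAnosov {n : ℕ} {Γ M : Type*} [Group Γ] [MulAction Γ M] [TopologicalSpace M]
    (Φ : Flow ℝ M) (ρ : Γ →* SO2 n) : Prop :=
  ∃ lp lm : M → Ein n, IsParallelSection Φ ρ lp ∧ IsParallelSection Φ ρ lm ∧
    (∀ p, (lp p, lm p) ∈ Y n) ∧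
    ∃ gp gm : MetricFamily (M := M) ρ,
      (∀ p, (p, lp p) ∈ gp.dom) ∧ (∀ p, (p, lm p) ∈ gm.dom) ∧
      ∃ a b : ℝ, 0 < a ∧ 0 < b ∧ ∀ (p : M) (t : ℝ), 0 ≤ t →
        (∀ w : tangent (lp p),
          a * Real.exp (b * t) * gp.g p (lp p) w w ≤ gp.g (Φ t p) (lp p) w w) ∧
        (∀ w : tangent (lm p),
          gm.g (Φ t p) (lm p) w w ≤ a⁻¹ * Real.exp (-(b * t)) * gm.g p (lm p) w w)

end EinAnosov

end

/-! Two things are missing from the hypotheses: uniform exponential rates, and the sign condition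
`sca < 0` on the pair of sections.

Rates. A section is constant along the flow, so a tangent vector `w` at its value can be measured at
every time; the ratio of its squared norm at time `t` to that at time `0` is a positive cocycle over
a flow on the unit tangent vectors along the section. By equivariance this cocycle is determined by
its restriction to a compact set, so doubling once along each orbit gives uniform exponential growth
(`exists_exp_le_cocycle`).

Transversality. Take `t` large and `γ` bringing `Φ t p` back to a compact set. In Euclidean norms `ρ
γ` then expands the tangent space at `x = lp p` by `C` and contracts the one at `y = lm p` by `c <
C`. The action is conformal for `sca` with factor `‖A x‖⁻²`, so each bound gives a dual one in the
opposite direction. If `sca x y = 0`, apply the dual bounds to the photon through `x` and `y`: its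
direction has squared norm `gram x y` at either end, and both dual bounds compare this with `gram (A
x) (A y)`, giving `C² gram (A x) (A y) ≤ gram x y ≤ c² gram (A x) (A y)`. Hence both vanish and `y =
± x`, where the two differentials agree, a contradiction (`sca_ne_zero_of_expands_of_contracts`).

Sign. Thus `sca (lp p) (lm p)` never vanishes, and its sign is continuous and invariant under `Γ`
and the flow. Where it is positive, `lm` is replaced by its antipode, which commutes with the action
and has the same tangent space. -/

noncomputable section

namespace EinAnosov

/-! ### The form, the Euclidean structure and tangent spaces -/

/-- The reflection of `ℝ^{2,n}` relating the form `sca` to the Euclidean inner product. -/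
def signFlip {n : ℕ} (w : R2 n) : R2 n :=
  WithLp.toLp 2 (Sum.elim (fun i => -w (Sum.inl i)) fun j => w (Sum.inr j))

theorem inner_signFlip {n : ℕ} (v w : R2 n) : inner ℝ v (signFlip w) = sca v w := by
  simp only [PiLp.inner_apply, signFlip, sca, Fintype.sum_sum_type, Sum.elim_inl, Sum.elim_inr,
    RCLike.inner_apply, conj_trivial, neg_mul, Finset.sum_neg_distrib]
  rw [neg_add_eq_sub]
  congr 1 <;> exact Finset.sum_congr rfl fun _ _ => mul_comm _ _

theorem sca_signFlip {n : ℕ} (v w : R2 n) : sca v (signFlip w) = inner ℝ v w := by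
  simp only [PiLp.inner_apply, signFlip, sca, Fintype.sum_sum_type, Sum.elim_inl, Sum.elim_inr,
    RCLike.inner_apply, conj_trivial, mul_neg, Finset.sum_neg_distrib, sub_neg_eq_add]
  rw [add_comm]
  congr 1 <;> exact Finset.sum_congr rfl fun _ _ => mul_comm _ _

theorem norm_signFlip {n : ℕ} (w : R2 n) : ‖signFlip w‖ = ‖w‖ := by
  have h : ‖signFlip w‖ ^ 2 = ‖w‖ ^ 2 := by
    rw [← real_inner_self_eq_norm_sq, ← real_inner_self_eq_norm_sq, inner_signFlip, sca_comm,
      sca_signFlip]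
  exact (pow_left_inj₀ (norm_nonneg _) (norm_nonneg _) two_ne_zero).1 h

theorem abs_sca_le {n : ℕ} (v w : R2 n) : |sca v w| ≤ ‖v‖ * ‖w‖ := by
  rw [← inner_signFlip, ← norm_signFlip w]
  exact abs_real_inner_le_norm _ _

theorem sca_sub_right {n : ℕ} (v w w' : R2 n) : sca v (w - w') = sca v w - sca v w' := by
  rw [sub_eq_add_neg, sca_add_right, ← neg_one_smul ℝ w', sca_smul_right]
  ring

theorem sca_sub_left {n : ℕ} (v v' w : R2 n) : sca (v - v') w = sca v w - sca v' w := by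
  rw [sca_comm, sca_sub_right, sca_comm w, sca_comm w]

theorem continuous_sca {n : ℕ} : Continuous fun z : R2 n × R2 n => sca z.1 z.2 := by
  unfold sca
  fun_prop

theorem signFlip_mem_tangent {n : ℕ} {x : Ein n} {w : R2 n} (hw : w ∈ tangent x) :
    signFlip w ∈ tangent x :=
  ⟨(inner_signFlip _ _).trans hw.2, (sca_signFlip _ _).trans hw.1⟩

/-- A quarter turn of the negative coordinates of `x` is orthogonal to `x` for both forms; it is
nonzero because a null vector without negative part is zero. -/
theorem exists_tangent_ne_zero {n : ℕ} (x : Ein n) : ∃ w ∈ tangent x, w ≠ 0 := by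
  refine ⟨WithLp.toLp 2 (Sum.elim ![-x.1 (Sum.inl 1), x.1 (Sum.inl 0)] fun _ => 0), ⟨?_, ?_⟩, ?_⟩
  · simp [PiLp.inner_apply]
    ring
  · simp [sca]
    ring
  · intro h
    have h0 : x.1 (Sum.inl 0) = 0 := by
      simpa using congrArg (fun v : R2 n => v (Sum.inl 1)) h
    have h1 : x.1 (Sum.inl 1) = 0 := by
      simpa using congrArg (fun v : R2 n => v (Sum.inl 0)) h
    have h2 := x.2.2
    have h3 : (inner ℝ x.1 x.1 : ℝ) = 0 := by
      rw [PiLp.inner_apply, Fintype.sum_sum_type]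
      simp only [sca, Fin.sum_univ_two, h0, h1] at h2 ⊢
      simpa [pow_two] using h2
    exact x.ne_zero (inner_self_eq_zero.1 h3)

/-! ### Conformality of the action -/

theorem norm_apply_pos {n : ℕ} (A : O2 n) (x : Ein n) : 0 < ‖A.1.1 x.1‖ :=
  norm_pos_iff.2 (apply_ne_zero A x.ne_zero)

theorem coe_smul_ein {n : ℕ} (A : O2 n) (x : Ein n) :
    (A • x).1 = ‖A.1.1 x.1‖⁻¹ • A.1.1 x.1 := rfl

/-- The differential of the action is the orthogonal projection, along the image of the base point,
of the rescaled linear action. -/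
theorem dAct_apply {n : ℕ} (A : O2 n) (x : Ein n) (w : tangent x) :
    (dAct A x w).1 = ‖A.1.1 x.1‖⁻¹ • (A.1.1 w.1 -
      (inner ℝ (A.1.1 x.1) (A.1.1 w.1) / ‖A.1.1 x.1‖ ^ 2) • A.1.1 x.1) := by
  have h0 : A.1.1 x.1 ≠ 0 := apply_ne_zero A x.ne_zero
  have hn := (norm_apply_pos A x).ne'
  have hA : DifferentiableAt ℝ (fun z => A.1.1 z) x.1 := A.1.1.differentiableAt
  have hc : DifferentiableAt ℝ (fun z => ‖A.1.1 z‖⁻¹) x.1 :=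
    (hA.norm ℝ h0).inv (norm_ne_zero_iff.2 h0)
  have h1 : fderiv ℝ (radial A) x.1 = _ :=
    (hc.hasFDerivAt.smul (A.1.1.hasFDerivAt (x := x.1))).fderiv
  -- Differentiating the normalising factor only adds a multiple of `A x`; orthogonality to `A • x`
  -- then determines the coefficient.
  obtain ⟨r, hr⟩ : ∃ r : ℝ, (dAct A x w).1 = ‖A.1.1 x.1‖⁻¹ • A.1.1 w.1 + r • A.1.1 x.1 := by
    refine ⟨fderiv ℝ (fun z => ‖A.1.1 z‖⁻¹) x.1 w.1, ?_⟩
    change fderiv ℝ (radial A) x.1 w.1 = _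
    rw [h1]
    simp only [add_apply, smul_apply, ContinuousLinearMap.smulRight_apply]
  have h2 : inner ℝ (A • x).1 (dAct A x w).1 = 0 := (dAct A x w).2.1
  rw [hr, coe_smul_ein, real_inner_smul_left, inner_add_right, inner_smul_right, inner_smul_right,
    real_inner_self_eq_norm_sq, mul_eq_zero, or_iff_right (inv_ne_zero hn)] at h2
  have hr' : r = -(‖A.1.1 x.1‖⁻¹ * (inner ℝ (A.1.1 x.1) (A.1.1 w.1) / ‖A.1.1 x.1‖ ^ 2)) := by
    field_simp at h2 ⊢
    linarith
  rw [hr, hr', smul_sub, smul_smul, neg_smul, sub_eq_add_neg]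

/-- The projection in `dAct_apply` only subtracts multiples of `A x`, which is null and
`sca`-orthogonal to the images of tangent vectors, so `sca` feels only the scaling. -/
theorem sca_dAct {n : ℕ} (A : O2 n) (x : Ein n) (v w : tangent x) :
    sca (dAct A x v).1 (dAct A x w).1 = (‖A.1.1 x.1‖ ^ 2)⁻¹ * sca v.1 w.1 := by
  have hv : sca v.1 x.1 = 0 := by rw [sca_comm]; exact v.2.2
  rw [dAct_apply, dAct_apply]
  simp only [sca_smul_left, sca_smul_right, sca_sub_left, sca_sub_right]
  rw [A.2, A.2, A.2, A.2, hv, w.2.2, x.2.2]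
  ring

theorem dAct_injective {n : ℕ} (A : O2 n) (x : Ein n) : Function.Injective (dAct A x) := by
  refine (injective_iff_map_eq_zero _).2 fun w hw => ?_
  have h := sca_dAct A x w ⟨signFlip w.1, signFlip_mem_tangent w.2⟩
  rw [hw, sca_signFlip] at h
  have h0 : sca ((0 : tangent (A • x)) : R2 n)
      (dAct A x ⟨signFlip w.1, signFlip_mem_tangent w.2⟩).1 = 0 := by
    simp [sca]
  rw [h0, eq_comm, mul_eq_zero,
    or_iff_right (inv_ne_zero (pow_ne_zero _ (norm_apply_pos A x).ne'))] at h
  exact Subtype.ext (inner_self_eq_zero.1 h)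

theorem dAct_surjective {n : ℕ} (A : O2 n) (x : Ein n) : Function.Surjective (dAct A x) := by
  intro v
  have hn := (norm_apply_pos A x).ne'
  have hA : ∀ u, A.1.1 ((A.1⁻¹).1 u) = u := fun u => by
    change (A.1.1 * (A.1⁻¹).1) u = u
    rw [Units.mul_inv]; rfl
  have hv1 : inner ℝ (A.1.1 x.1) v.1 = 0 := by
    have h : inner ℝ (A • x).1 v.1 = 0 := v.2.1
    rwa [coe_smul_ein, real_inner_smul_left, mul_eq_zero, or_iff_right (inv_ne_zero hn)] at h
  have hv2 : sca (A.1.1 x.1) v.1 = 0 := by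
    have h : sca (A • x).1 v.1 = 0 := v.2.2
    rwa [coe_smul_ein, sca_smul_left, mul_eq_zero, or_iff_right (inv_ne_zero hn)] at h
  -- `u` is a preimage up to a multiple of `x`, and the projection in `dAct_apply` does not see that
  -- multiple.
  set u : R2 n := (A.1⁻¹).1 (‖A.1.1 x.1‖ • v.1) with hu
  have hAu : A.1.1 u = ‖A.1.1 x.1‖ • v.1 := hA _
  have hxu : sca x.1 u = 0 := by rw [← A.2, hAu, sca_smul_right, hv2, mul_zero]
  refine ⟨⟨u - inner ℝ x.1 u • x.1, ?_, ?_⟩, ?_⟩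
  · rw [inner_sub_right, inner_smul_right, real_inner_self_eq_norm_sq, x.2.1]
    ring
  · rw [sca_sub_right, sca_smul_right, x.2.2, hxu]
    ring
  · apply Subtype.ext
    rw [dAct_apply]
    simp only [map_sub, map_smul, hAu, inner_sub_right, inner_smul_right, hv1,
      real_inner_self_eq_norm_sq]
    have h : (‖A.1.1 x.1‖ * 0 - inner ℝ x.1 u * ‖A.1.1 x.1‖ ^ 2) / ‖A.1.1 x.1‖ ^ 2
        = - inner ℝ x.1 u := by
      field_simp
      ring
    rw [h, neg_smul, sub_neg_eq_add, sub_add_cancel, smul_smul, inv_mul_cancel₀ hn, one_smul]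

/-- A conformal contraction cannot contract too much. -/
theorem norm_le_of_dAct_contracts {n : ℕ} (A : O2 n) (x : Ein n) {c : ℝ}
    (h : ∀ w : tangent x, ‖(dAct A x w).1‖ ≤ c * ‖w.1‖) (w : tangent x) :
    ‖w.1‖ ≤ c * (‖A.1.1 x.1‖ ^ 2 * ‖(dAct A x w).1‖) := by
  have hn := norm_apply_pos A x
  rcases eq_or_ne w.1 0 with h0 | h0
  · have : w = 0 := Subtype.ext h0
    simp [this]
  · have hw := norm_pos_iff.2 h0
    -- The flip is a Euclidean isometry with `sca w w' = ‖w‖²`, so conformality turns the bound on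
    -- the image of `w'` into one for `w`.
    set w' : tangent x := ⟨signFlip w.1, signFlip_mem_tangent w.2⟩
    have h1 := sca_dAct A x w w'
    have h2 : sca w.1 w'.1 = ‖w.1‖ ^ 2 := by
      rw [← real_inner_self_eq_norm_sq]; exact sca_signFlip _ _
    have h3 := (le_abs_self _).trans (abs_sca_le (dAct A x w).1 (dAct A x w').1)
    have h4 : ‖(dAct A x w').1‖ ≤ c * ‖w.1‖ := by
      simpa only [w', norm_signFlip] using h w'
    rw [h1, h2, inv_mul_le_iff₀ (by positivity)] at h3
    have h5 := mul_le_mul_of_nonneg_left h4 (norm_nonneg (dAct A x w).1)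
    have h6 := mul_le_mul_of_nonneg_left h5 (sq_nonneg ‖A.1.1 x.1‖)
    nlinarith

/-- A conformal expansion cannot expand too much. -/
theorem dAct_le_of_dAct_expands {n : ℕ} (A : O2 n) (x : Ein n) {C : ℝ}
    (h : ∀ w : tangent x, C * ‖w.1‖ ≤ ‖(dAct A x w).1‖) (w : tangent x) :
    C * (‖A.1.1 x.1‖ ^ 2 * ‖(dAct A x w).1‖) ≤ ‖w.1‖ := by
  have hn := norm_apply_pos A x
  rcases le_or_gt C 0 with hC | hC
  · exact (mul_nonpos_of_nonpos_of_nonneg hC (by positivity)).trans (norm_nonneg _)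
  rcases eq_or_ne (dAct A x w).1 0 with h0 | h0
  · rw [h0, norm_zero, mul_zero, mul_zero]
    exact norm_nonneg _
  · have hw := norm_pos_iff.2 h0
    obtain ⟨w', hw'⟩ := dAct_surjective A x ⟨_, signFlip_mem_tangent (dAct A x w).2⟩
    have h1 := sca_dAct A x w w'
    have h2 : sca (dAct A x w).1 (dAct A x w').1 = ‖(dAct A x w).1‖ ^ 2 := by
      rw [hw', ← real_inner_self_eq_norm_sq]; exact sca_signFlip _ _
    have h3 := (le_abs_self _).trans (abs_sca_le w.1 w'.1)
    have h4 : C * ‖w'.1‖ ≤ ‖(dAct A x w).1‖ := by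
      simpa only [hw', norm_signFlip] using h w'
    rw [h2, eq_inv_mul_iff_mul_eq₀ (by positivity)] at h1
    rw [← h1] at h3
    have h5 := mul_le_mul_of_nonneg_left h4 (norm_nonneg w.1)
    have h6 := mul_le_mul_of_nonneg_left h3 hC.le
    nlinarith

/-! ### Photons and the incompatibility of source and sink -/

/-- The Gram determinant of two vectors. -/
def gram {n : ℕ} (v w : R2 n) : ℝ := ‖v‖ ^ 2 * ‖w‖ ^ 2 - inner ℝ v w ^ 2

theorem gram_comm {n : ℕ} (v w : R2 n) : gram v w = gram w v := by
  rw [gram, gram, real_inner_comm, mul_comm]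

/-- The direction at `x` of the photon through the causally related points `x` and `y`. -/
def photonDir {n : ℕ} (x y : Ein n) (h : sca x.1 y.1 = 0) : tangent x :=
  ⟨y.1 - inner ℝ x.1 y.1 • x.1, by
    rw [inner_sub_right, inner_smul_right, real_inner_self_eq_norm_sq, x.2.1]
    ring, by
    rw [sca_sub_right, sca_smul_right, x.2.2, h]
    ring⟩

theorem norm_photonDir {n : ℕ} (x y : Ein n) (h : sca x.1 y.1 = 0) :
    ‖(photonDir x y h).1‖ ^ 2 = gram x.1 y.1 := by
  simp only [photonDir, gram]
  rw [norm_sub_sq_real, norm_smul, inner_smul_right, x.2.1, y.2.1, real_inner_comm, mul_one,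
    Real.norm_eq_abs, sq_abs]
  ring

/-- The image is `‖A x‖⁻¹` times the component of `A y` orthogonal to `A x`, whose length is the
area of the parallelogram on `A x`, `A y` divided by `‖A x‖`. The weight `‖A x‖ ^ 2` cancels both
factors and leaves a quantity symmetric in `x` and `y`. -/
theorem norm_dAct_photonDir {n : ℕ} (A : O2 n) (x y : Ein n) (h : sca x.1 y.1 = 0) :
    (‖A.1.1 x.1‖ ^ 2 * ‖(dAct A x (photonDir x y h)).1‖) ^ 2 = gram (A.1.1 x.1) (A.1.1 y.1) := by
  have hn := (norm_apply_pos A x).ne'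
  have h1 : (dAct A x (photonDir x y h)).1 = ‖A.1.1 x.1‖⁻¹ • (A.1.1 y.1 -
      (inner ℝ (A.1.1 x.1) (A.1.1 y.1) / ‖A.1.1 x.1‖ ^ 2) • A.1.1 x.1) := by
    rw [dAct_apply]
    congr 1
    simp only [photonDir, map_sub, map_smul, inner_sub_right, inner_smul_right,
      real_inner_self_eq_norm_sq]
    rw [sub_sub, ← add_smul]
    congr 2
    field_simp
    ring
  rw [h1, norm_smul, norm_inv, norm_norm, mul_pow, mul_pow, norm_sub_sq_real, norm_smul,
    inner_smul_right, real_inner_comm, gram, Real.norm_eq_abs, mul_pow, sq_abs]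
  field_simp
  rw [real_inner_comm]
  ring

/-- Causally related points cannot be respectively a source and a sink of one element
of `O(2,n)`. -/
theorem sca_ne_zero_of_expands_of_contracts {n : ℕ} (A : O2 n) (x y : Ein n) {c C : ℝ} (hc : 0 < c)
    (hcC : c < C) (hx : ∀ w : tangent x, C * ‖w.1‖ ≤ ‖(dAct A x w).1‖)
    (hy : ∀ w : tangent y, ‖(dAct A y w).1‖ ≤ c * ‖w.1‖) : sca x.1 y.1 ≠ 0 := by
  intro h
  have h' : sca y.1 x.1 = 0 := by rwa [sca_comm]
  have h1 := dAct_le_of_dAct_expands A x hx (photonDir x y h)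
  have h2 := norm_le_of_dAct_contracts A y hy (photonDir y x h')
  have h3 := pow_le_pow_left₀ (mul_nonneg (hc.trans hcC).le (by positivity)) h1 2
  have h4 := pow_le_pow_left₀ (norm_nonneg _) h2 2
  rw [mul_pow, norm_dAct_photonDir, norm_photonDir] at h3 h4
  rw [gram_comm, gram_comm (A.1.1 y.1)] at h4
  have hG : 0 ≤ gram (A.1.1 x.1) (A.1.1 y.1) := by
    rw [← norm_dAct_photonDir A x y h]; positivity
  have hg : gram x.1 y.1 = 0 := by
    have hle : 0 ≤ gram x.1 y.1 := by rw [← norm_photonDir x y h]; positivity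
    have : c ^ 2 < C ^ 2 := pow_lt_pow_left₀ hcC hc.le two_ne_zero
    have hG0 : gram (A.1.1 x.1) (A.1.1 y.1) = 0 := by nlinarith
    rw [hG0] at h4
    linarith
  -- Degenerate case `y = ± x`: the photon direction is zero and carries no information, so another
  -- tangent vector is used.
  set s : ℝ := inner ℝ x.1 y.1 with hs
  have hyx : y.1 = s • x.1 := by
    rw [← norm_photonDir x y h, sq_eq_zero_iff, norm_eq_zero] at hg
    exact sub_eq_zero.1 hg
  have hs1 : |s| = 1 := by
    have := y.2.1
    rwa [hyx, norm_smul, x.2.1, mul_one] at this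
  obtain ⟨w, hw, hw0⟩ := exists_tangent_ne_zero x
  have hwy : w ∈ tangent y := ⟨by rw [hyx, real_inner_smul_left, hw.1, mul_zero], by
    rw [hyx, sca_smul_left, hw.2, mul_zero]⟩
  have hD : (dAct A x ⟨w, hw⟩).1 = (dAct A y ⟨w, hwy⟩).1 := by
    have hss : s * s = 1 := by rw [← abs_mul_abs_self, hs1, one_mul]
    rw [dAct_apply, dAct_apply]
    simp only [hyx, map_smul, norm_smul, Real.norm_eq_abs, hs1, one_mul, real_inner_smul_left,
      smul_smul]
    rw [mul_div_assoc, mul_right_comm, hss, one_mul]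
  have h5 := hx ⟨w, hw⟩
  have h6 := hy ⟨w, hwy⟩
  rw [← hD] at h6
  exact absurd (h5.trans h6) (not_le.2 (mul_lt_mul_of_pos_right hcC (norm_pos_iff.2 hw0)))

/-! ### Uniform exponential growth from compactness -/

/-- A positive continuous cocycle over a flow, on a space that is compact up to symmetries of
the cocycle, grows exponentially as soon as it doubles once along each orbit. -/
theorem exists_exp_le_cocycle {S : Type*} [TopologicalSpace S] (φ : ℝ → S → S) (c : S → ℝ → ℝ)
    (hc : Continuous fun z : S × ℝ => c z.1 z.2) (hpos : ∀ e t, 0 < c e t)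
    (hcoc : ∀ e s t, c e (s + t) = c e s * c (φ s e) t) {K : Set S} (hK : IsCompact K)
    (hKS : ∀ e, ∃ e' ∈ K, ∀ t, c e t = c e' t) (h : ∀ e, ∃ t, 0 < t ∧ 2 ≤ c e t) :
    ∃ a b : ℝ, 0 < a ∧ 0 < b ∧ ∀ e t, 0 ≤ t → a * Real.exp (b * t) ≤ c e t := by
  -- Lowering the gain from `2` to `exp (1 / 2)` leaves room for the same time to work on a
  -- neighbourhood.
  have hexp : Real.exp (1 / 2) < 2 := by
    have h1 : Real.exp (1 / 2) ^ 2 = Real.exp 1 := by rw [← Real.exp_nat_mul]; norm_num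
    nlinarith [Real.exp_one_lt_d9, Real.exp_pos (1 / 2)]
  obtain ⟨τ, T, hτ, hτT, hτK⟩ : ∃ τ T : ℝ, 0 < τ ∧ τ ≤ T ∧
      ∀ e ∈ K, ∃ s, τ ≤ s ∧ s ≤ T ∧ Real.exp (1 / 2) ≤ c e s := by
    refine hK.induction_on (p := fun K' => ∃ τ T : ℝ, 0 < τ ∧ τ ≤ T ∧
      ∀ e ∈ K', ∃ s, τ ≤ s ∧ s ≤ T ∧ Real.exp (1 / 2) ≤ c e s) ?_ ?_ ?_ ?_
    · exact ⟨1, 1, one_pos, le_rfl, by simp⟩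
    · rintro s t hst ⟨τ, T, h1, h2, h3⟩
      exact ⟨τ, T, h1, h2, fun e he => h3 e (hst he)⟩
    · rintro s t ⟨τ, T, h1, h2, h3⟩ ⟨τ', T', h1', h2', h3'⟩
      refine ⟨min τ τ', max T T', lt_min h1 h1', (min_le_left _ _).trans (h2.trans (le_max_left _ _)),
        ?_⟩
      rintro e (he | he)
      · obtain ⟨r, hr1, hr2, hr3⟩ := h3 e he
        exact ⟨r, (min_le_left _ _).trans hr1, hr2.trans (le_max_left _ _), hr3⟩
      · obtain ⟨r, hr1, hr2, hr3⟩ := h3' e he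
        exact ⟨r, (min_le_right _ _).trans hr1, hr2.trans (le_max_right _ _), hr3⟩
    · intro e _
      obtain ⟨t, ht, hct⟩ := h e
      have hcont : Continuous fun e => c e t := hc.comp (Continuous.prodMk_left t)
      exact ⟨{e' | Real.exp (1 / 2) < c e' t}, mem_nhdsWithin_of_mem_nhds
        ((isOpen_lt continuous_const hcont).mem_nhds (hexp.trans_le hct)), t, t, ht, le_rfl,
        fun e' he' => ⟨t, le_rfl, le_rfl, le_of_lt he'⟩⟩
  have hT : 0 < T := hτ.trans_le hτT
  obtain ⟨m, hm, hmK⟩ : ∃ m : ℝ, 0 < m ∧ ∀ e ∈ K, ∀ t ∈ Set.Icc 0 T, m ≤ c e t := by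
    obtain ⟨m, hm, hmK⟩ := (hK.prod (isCompact_Icc (a := (0 : ℝ)) (b := T))).exists_forall_le'
      hc.continuousOn (a := 0) fun z _ => hpos z.1 z.2
    exact ⟨m, hm, fun e he t ht => hmK (e, t) ⟨he, ht⟩⟩
  -- Each step gains `exp (1 / 2)` in time at most `T`, whence the rate `1 / (2 * T)`; the factor `m
  -- * exp (-(1 / 2))` pays for the last incomplete step. Steps last at least `τ`, so the induction
  -- on `N` reaches every `t`.
  have key : ∀ (N : ℕ) (e : S) (t : ℝ), 0 ≤ t → t ≤ N * τ →
      m * Real.exp (-(1 / 2)) * Real.exp (1 / (2 * T) * t) ≤ c e t := by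
    have base : ∀ (e : S) (t : ℝ), 0 ≤ t → t ≤ T →
        m * Real.exp (-(1 / 2)) * Real.exp (1 / (2 * T) * t) ≤ c e t := by
      intro e t ht htT
      obtain ⟨e', he', hee'⟩ := hKS e
      rw [hee', mul_assoc, ← Real.exp_add]
      have h1 : 1 / (2 * T) * t ≤ 1 / 2 := by
        rw [one_div_mul_eq_div, div_le_iff₀ (by positivity)]
        linarith
      have h2 : Real.exp (-(1 / 2) + 1 / (2 * T) * t) ≤ 1 := Real.exp_le_one_iff.2 (by linarith)
      exact (mul_le_of_le_one_right hm.le h2).trans (hmK e' he' t ⟨ht, htT⟩)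
    intro N
    induction N with
    | zero =>
      intro e t ht htN
      exact base e t ht (htN.trans (by simpa using hT.le))
    | succ N ih =>
      intro e t ht htN
      rcases le_or_gt t T with htT | htT
      · exact base e t ht htT
      · obtain ⟨e', he', hee'⟩ := hKS e
        obtain ⟨s, hs1, hs2, hs3⟩ := hτK e' he'
        rw [← hee'] at hs3
        push_cast at htN
        have h1 := ih (φ s e) (t - s) (by linarith) (by linarith)
        have h2 : c e t = c e s * c (φ s e) (t - s) := by rw [← hcoc, add_sub_cancel]
        have h3 : 1 / (2 * T) * t ≤ 1 / 2 + 1 / (2 * T) * (t - s) := by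
          have : 1 / (2 * T) * s ≤ 1 / 2 := by
            rw [one_div_mul_eq_div, div_le_iff₀ (by positivity)]
            linarith
          linarith
        calc m * Real.exp (-(1 / 2)) * Real.exp (1 / (2 * T) * t)
            ≤ m * Real.exp (-(1 / 2)) * Real.exp (1 / 2 + 1 / (2 * T) * (t - s)) := by gcongr
          _ = Real.exp (1 / 2) *
              (m * Real.exp (-(1 / 2)) * Real.exp (1 / (2 * T) * (t - s))) := by
            rw [Real.exp_add]; ring
          _ ≤ c e s * c (φ s e) (t - s) :=
            mul_le_mul hs3 h1 (by positivity) (hpos _ _).le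
          _ = c e t := h2.symm
  refine ⟨m * Real.exp (-(1 / 2)), 1 / (2 * T), by positivity, by positivity, fun e t ht => ?_⟩
  obtain ⟨N, hN⟩ := exists_nat_ge (t / τ)
  exact key N e t ht ((div_le_iff₀ hτ).1 hN)

/-- A cocompact action on a locally compact space has a compact set meeting every orbit. -/
theorem exists_isCompact_smul_mem (Γ M : Type*) [Group Γ] [TopologicalSpace M]
    [LocallyCompactSpace M] [MulAction Γ M] [ContinuousConstSMul Γ M]
    [CompactSpace (MulAction.orbitRel.Quotient Γ M)] :
    ∃ K : Set M, IsCompact K ∧ ∀ p : M, ∃ γ : Γ, γ • p ∈ K := by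
  have hopen : IsOpenMap (Quotient.mk (MulAction.orbitRel Γ M)) := isOpenMap_quotient_mk'_mul
  obtain ⟨K, hK, hKM⟩ : ∃ K : Set M, IsCompact K ∧
      Set.univ ⊆ Quotient.mk (MulAction.orbitRel Γ M) '' K := by
    refine (isCompact_univ (X := MulAction.orbitRel.Quotient Γ M)).induction_on
      (p := fun s => ∃ K : Set M, IsCompact K ∧ s ⊆ Quotient.mk (MulAction.orbitRel Γ M) '' K)
      ⟨∅, isCompact_empty, Set.empty_subset _⟩ ?_ ?_ ?_
    · rintro s t hst ⟨K, hK, h⟩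
      exact ⟨K, hK, hst.trans h⟩
    · rintro s t ⟨K, hK, h⟩ ⟨K', hK', h'⟩
      exact ⟨K ∪ K', hK.union hK', by
        rw [Set.image_union]; exact Set.union_subset_union h h'⟩
    · intro q _
      induction q using Quotient.inductionOn with
      | h p =>
        obtain ⟨K, hK, hKp⟩ := exists_compact_mem_nhds p
        exact ⟨_, mem_nhdsWithin_of_mem_nhds (hopen.image_mem_nhds hKp), K, hK, subset_rfl⟩
  refine ⟨K, hK, fun p => ?_⟩
  obtain ⟨q, hq, hqp⟩ := hKM (Set.mem_univ (Quotient.mk (MulAction.orbitRel Γ M) p))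
  obtain ⟨γ, hγ⟩ := MulAction.orbitRel_apply.1 (Quotient.exact hqp)
  exact ⟨γ, by simpa [hγ] using hq⟩

theorem sqrt_mul_le_of_mul_sq_le {k c C x y : ℝ} (hk : 0 < k) (hc : 0 < c) (hC : 0 < C)
    (hy : 0 ≤ y) (h : k * (c * x ^ 2) ≤ C * y ^ 2) : √(k * c / C) * x ≤ y := by
  refine le_of_sq_le_sq ?_ hy
  rw [mul_pow, Real.sq_sqrt (by positivity), div_mul_eq_mul_div, div_le_iff₀ hC]
  linarith

theorem le_sqrt_mul_of_mul_sq_le {k c C x y : ℝ} (hk : 0 < k) (hc : 0 < c) (hC : 0 < C)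
    (hy : 0 ≤ y) (h : k * (c * x ^ 2) ≤ C * y ^ 2) : x ≤ √(C / (k * c)) * y := by
  refine le_of_sq_le_sq ?_ (by positivity)
  rw [mul_pow, Real.sq_sqrt (by positivity), div_mul_eq_mul_div, le_div_iff₀ (by positivity)]
  linarith

theorem mul_exp_mul_le_of_le {a a' b b' t x y : ℝ} (ha : a ≤ a') (hb : b ≤ b') (ha' : 0 ≤ a')
    (ht : 0 ≤ t) (hx : 0 ≤ x) (h : a' * Real.exp (b' * t) * x ≤ y) :
    a * Real.exp (b * t) * x ≤ y := by
  refine (mul_le_mul_of_nonneg_right ?_ hx).trans h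
  gcongr

theorem le_inv_mul_exp_neg_mul {a s x y : ℝ} (ha : 0 < a) (h : a * Real.exp s * y ≤ x) :
    y ≤ a⁻¹ * Real.exp (-s) * x := by
  rwa [Real.exp_neg, ← mul_inv, ← div_eq_inv_mul, le_div_iff₀' (by positivity)]

/-! ### Metric families along a parallel section -/

section Families

variable {n : ℕ} {Γ M : Type*} [Group Γ] [MulAction Γ M] [TopologicalSpace M] {ρ : Γ →* SO2 n}

theorem MetricFamily.g_congr (G : MetricFamily (M := M) ρ) {p p' : M} {x x' : Ein n} (hp : p = p')
    (hx : x = x') {v w : tangent x} {v' w' : tangent x'} (hv : v.1 = v'.1) (hw : w.1 = w'.1) :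
    G.g p x v w = G.g p' x' v' w' := by
  subst hp hx
  rw [Subtype.ext hv, Subtype.ext hw]

theorem MetricFamily.g_self_nonneg (G : MetricFamily (M := M) ρ) {p : M} {x : Ein n}
    (h : (p, x) ∈ G.dom) (w : tangent x) : 0 ≤ G.g p x w w := by
  rcases eq_or_ne w 0 with rfl | hw
  · simp
  · exact (G.pos p x h w hw).le

theorem MetricFamily.g_smul_smul (G : MetricFamily (M := M) ρ) (p : M) (x : Ein n) (r : ℝ)
    (w : tangent x) : G.g p x (r • w) (r • w) = r ^ 2 * G.g p x w w := by
  simp only [map_smul, LinearMap.smul_apply, smul_eq_mul]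
  ring

theorem MetricFamily.g_smul (G : MetricFamily (M := M) ρ) (γ : Γ) {q : M} {x x' : Ein n}
    (hd : (q, x) ∈ G.dom) (hx : x' = (ρ γ : O2 n) • x) (w : tangent x)
    (h : (dAct (ρ γ : O2 n) x w).1 ∈ tangent x') :
    G.g (γ • q) x' ⟨(dAct (ρ γ : O2 n) x w).1, h⟩ ⟨(dAct (ρ γ : O2 n) x w).1, h⟩ =
      G.g q x w w := by
  subst hx
  exact G.equivariant γ q x hd w w

/-- The unit tangent vectors of `Ein_n` along a map to `Ein_n`. -/
def UnitTangent (l : M → Ein n) : Type _ :=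
  {z : M × R2 n // z.2 ∈ tangent (l z.1) ∧ ‖z.2‖ = 1}

instance (l : M → Ein n) : TopologicalSpace (UnitTangent l) :=
  inferInstanceAs (TopologicalSpace {z : M × R2 n // z.2 ∈ tangent (l z.1) ∧ ‖z.2‖ = 1})

theorem isCompact_unitTangent {l : M → Ein n} (hl : Continuous l) {K : Set M} (hK : IsCompact K) :
    IsCompact {e : UnitTangent l | e.1.1 ∈ K} := by
  have hl' : Continuous fun z : M × R2 n => (l z.1).1 :=
    continuous_subtype_val.comp (hl.comp continuous_fst)
  have hclosed : IsClosed {z : M × R2 n | z.2 ∈ tangent (l z.1) ∧ ‖z.2‖ = 1} := by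
    have h1 : IsClosed {z : M × R2 n | inner ℝ (l z.1).1 z.2 = 0} :=
      isClosed_eq (hl'.inner continuous_snd) continuous_const
    have h2 : IsClosed {z : M × R2 n | sca (l z.1).1 z.2 = 0} :=
      isClosed_eq (continuous_sca.comp (hl'.prodMk continuous_snd)) continuous_const
    have h3 : IsClosed {z : M × R2 n | ‖z.2‖ = 1} :=
      isClosed_eq continuous_snd.norm continuous_const
    exact (h1.inter h2).inter h3
  have h := hclosed.isClosedEmbedding_subtypeVal.isCompact_preimage
    (hK.prod (isCompact_sphere (0 : R2 n) 1))
  have heq : {e : UnitTangent l | e.1.1 ∈ K} =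
      Subtype.val ⁻¹' (K ×ˢ Metric.sphere (0 : R2 n) 1) := by
    ext e
    exact ⟨fun h => ⟨h, mem_sphere_zero_iff_norm.2 e.2.2⟩, fun h => h.1⟩
  rw [heq]
  exact h

/-- The direction of a nonzero tangent vector. -/
def unitTangentMk {l : M → Ein n} (p : M) (w : tangent (l p)) (hw : w.1 ≠ 0) : UnitTangent l :=
  ⟨(p, (‖w.1‖⁻¹ • w).1), (‖w.1‖⁻¹ • w).2, by
    change ‖‖w.1‖⁻¹ • w.1‖ = 1
    rw [norm_smul, norm_inv, norm_norm, inv_mul_cancel₀ (norm_ne_zero_iff.2 hw)]⟩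

/-- The norm of a unit tangent vector at `p`, for the metric at the point of parameter `t` on the
orbit of `p`. -/
def MetricFamily.along (G : MetricFamily (M := M) ρ) (Φ : Flow ℝ M) {l : M → Ein n}
    (e : UnitTangent l) (t : ℝ) : ℝ :=
  G.g (Φ t e.1.1) (l e.1.1) ⟨e.1.2, e.2.1⟩ ⟨e.1.2, e.2.1⟩

theorem MetricFamily.along_mk (G : MetricFamily (M := M) ρ) (Φ : Flow ℝ M) {l : M → Ein n} (p : M)
    (w : tangent (l p)) (hw : w.1 ≠ 0) (t : ℝ) :
    G.along Φ (unitTangentMk p w hw) t = (‖w.1‖⁻¹) ^ 2 * G.g (Φ t p) (l p) w w :=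
  G.g_smul_smul (Φ t p) (l p) ‖w.1‖⁻¹ w

variable {Φ : Flow ℝ M} {l : M → Ein n}

theorem MetricFamily.continuous_along (G : MetricFamily (M := M) ρ)
    (hl : IsParallelSection Φ ρ l) (hdom : ∀ p, (p, l p) ∈ G.dom) :
    Continuous fun z : UnitTangent l × ℝ => G.along Φ z.1 z.2 := by
  have hv : Continuous fun e : UnitTangent l => e.1 := continuous_subtype_val
  have hf : Continuous fun z : UnitTangent l × ℝ =>
      ((Φ z.2 z.1.1.1, ⟨(l z.1.1.1, z.1.1.2), z.1.2.1⟩) : M × TEin n) := by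
    refine Continuous.prodMk ?_ (Continuous.subtype_mk ?_ _)
    · exact Φ.cont'.comp (continuous_snd.prodMk (continuous_fst.comp (hv.comp continuous_fst)))
    · exact (hl.continuous.comp (continuous_fst.comp (hv.comp continuous_fst))).prodMk
        (continuous_snd.comp (hv.comp continuous_fst))
  refine G.cont.comp_continuous hf fun z => ?_
  have h := hdom (Φ z.2 z.1.1.1)
  rwa [hl.flow_invariant] at h

theorem MetricFamily.along_pos (G : MetricFamily (M := M) ρ)
    (hl : IsParallelSection Φ ρ l) (hdom : ∀ p, (p, l p) ∈ G.dom) (e : UnitTangent l) (t : ℝ) :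
    0 < G.along Φ e t := by
  refine G.pos _ _ ?_ _ ?_
  · have h := hdom (Φ t e.1.1)
    rwa [hl.flow_invariant] at h
  · intro h
    have h0 : e.1.2 = 0 := congrArg Subtype.val h
    have h1 := e.2.2
    rw [h0, norm_zero] at h1
    exact zero_ne_one h1

/-- `Γ` does not preserve the Euclidean unit sphere, so a translated vector is renormalised; the
resulting `r` does not depend on `t` and cancels in ratios of norms. -/
theorem MetricFamily.exists_isCompact_along [LocallyCompactSpace M] [ContinuousConstSMul Γ M]
    [CompactSpace (MulAction.orbitRel.Quotient Γ M)] (G : MetricFamily (M := M) ρ)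
    (hΦ : ∀ (t : ℝ) (γ : Γ) (p : M), Φ t (γ • p) = γ • Φ t p)
    (hl : IsParallelSection Φ ρ l) (hdom : ∀ p, (p, l p) ∈ G.dom) :
    ∃ K : Set (UnitTangent l), IsCompact K ∧ ∀ e : UnitTangent l, ∃ e' ∈ K, ∃ r : ℝ, 0 < r ∧
      ∀ t, G.along Φ e' t = r * G.along Φ e t := by
  obtain ⟨K, hK, hKM⟩ := exists_isCompact_smul_mem Γ M
  refine ⟨_, isCompact_unitTangent hl.continuous hK, fun e => ?_⟩
  obtain ⟨γ, hγ⟩ := hKM e.1.1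
  have he := hl.equivariant γ e.1.1
  set w := dAct (ρ γ : O2 n) (l e.1.1) ⟨e.1.2, e.2.1⟩ with hw
  have hw0 : w.1 ≠ 0 := by
    intro h
    have h0 : w = 0 := Subtype.ext h
    rw [hw, map_eq_zero_iff _ (dAct_injective _ _)] at h0
    have h1 := e.2.2
    rw [show e.1.2 = 0 from congrArg Subtype.val h0, norm_zero] at h1
    exact zero_ne_one h1
  have hmem : w.1 ∈ tangent (l (γ • e.1.1)) := by rw [he]; exact w.2
  refine ⟨unitTangentMk (γ • e.1.1) ⟨w.1, hmem⟩ hw0, hγ, (‖w.1‖⁻¹) ^ 2,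
    pow_pos (inv_pos.2 (norm_pos_iff.2 hw0)) 2, fun t => ?_⟩
  rw [G.along_mk]
  congr 1
  have hd := hdom (Φ t e.1.1)
  rw [hl.flow_invariant] at hd
  exact (G.g_congr (hΦ t γ e.1.1) he rfl rfl).trans (G.equivariant γ _ _ hd _ _)

theorem MetricFamily.along_flow (G : MetricFamily (M := M) ρ) (hl : IsParallelSection Φ ρ l)
    (e : UnitTangent l) (s t : ℝ) (h : e.1.2 ∈ tangent (l (Φ s e.1.1)) ∧ ‖e.1.2‖ = 1) :
    G.along Φ (⟨(Φ s e.1.1, e.1.2), h⟩ : UnitTangent l) t = G.along Φ e (s + t) :=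
  G.g_congr (by rw [add_comm, Φ.map_add]) (hl.flow_invariant s e.1.1) rfl rfl

/-- The cocycle is `along e t / along e 0`, over the flow that moves the base point and keeps the
vector. -/
theorem MetricFamily.exists_exp_le [LocallyCompactSpace M] [ContinuousConstSMul Γ M]
    [CompactSpace (MulAction.orbitRel.Quotient Γ M)] (G : MetricFamily (M := M) ρ)
    (hΦ : ∀ (t : ℝ) (γ : Γ) (p : M), Φ t (γ • p) = γ • Φ t p)
    (hl : IsParallelSection Φ ρ l) (hdom : ∀ p, (p, l p) ∈ G.dom)
    (h : ∀ p : M, ∃ t : ℝ, 0 < t ∧ ∀ w : tangent (l p),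
      2 * G.g p (l p) w w ≤ G.g (Φ t p) (l p) w w) :
    ∃ a b : ℝ, 0 < a ∧ 0 < b ∧ ∀ (p : M) (t : ℝ), 0 ≤ t → ∀ w : tangent (l p),
      a * Real.exp (b * t) * G.g p (l p) w w ≤ G.g (Φ t p) (l p) w w := by
  obtain ⟨K, hK, hKS⟩ := G.exists_isCompact_along hΦ hl hdom
  have hpos := G.along_pos hl hdom
  have hcont := G.continuous_along hl hdom
  have hz : ∀ e : UnitTangent l, G.along Φ e 0 = G.g e.1.1 (l e.1.1) ⟨_, e.2.1⟩ ⟨_, e.2.1⟩ :=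
    fun e => G.g_congr (Φ.map_zero_apply _) rfl rfl rfl
  obtain ⟨a, b, ha, hb, hab⟩ := exists_exp_le_cocycle
    (fun s (e : UnitTangent l) => (⟨(Φ s e.1.1, e.1.2), by
      rw [hl.flow_invariant]; exact e.2⟩ : UnitTangent l))
    (fun e t => G.along Φ e t / G.along Φ e 0)
    (hcont.div (hcont.comp (continuous_fst.prodMk continuous_const)) fun z => (hpos z.1 0).ne')
    (fun e t => div_pos (hpos e t) (hpos e 0))
    (fun e s t => by
      simp only [G.along_flow hl, add_zero]
      have := (hpos e s).ne'
      have := (hpos e 0).ne'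
      field_simp) hK
    (fun e => by
      obtain ⟨e', he', r, hr, h⟩ := hKS e
      exact ⟨e', he', fun t => by rw [h, h, mul_div_mul_left _ _ hr.ne']⟩)
    (fun e => by
      obtain ⟨t, ht, h⟩ := h e.1.1
      refine ⟨t, ht, ?_⟩
      rw [le_div_iff₀ (hpos e 0), hz]
      exact h _)
  refine ⟨a, b, ha, hb, fun p t ht w => ?_⟩
  rcases eq_or_ne w 0 with rfl | hw
  · simp
  · have hw : w.1 ≠ 0 := fun h => hw (Subtype.ext h)
    have h1 := hab (unitTangentMk p w hw) t ht
    have hr : 0 < (‖w.1‖⁻¹) ^ 2 := pow_pos (inv_pos.2 (norm_pos_iff.2 hw)) 2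
    rw [le_div_iff₀ (hpos _ _), G.along_mk, G.along_mk, Φ.map_zero_apply, mul_left_comm] at h1
    exact le_of_mul_le_mul_left h1 hr

/-- Contraction is growth of the inverse cocycle `along e 0 / along e t`. -/
theorem MetricFamily.exists_le_exp [LocallyCompactSpace M] [ContinuousConstSMul Γ M]
    [CompactSpace (MulAction.orbitRel.Quotient Γ M)] (G : MetricFamily (M := M) ρ)
    (hΦ : ∀ (t : ℝ) (γ : Γ) (p : M), Φ t (γ • p) = γ • Φ t p)
    (hl : IsParallelSection Φ ρ l) (hdom : ∀ p, (p, l p) ∈ G.dom)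
    (h : ∀ p : M, ∃ t : ℝ, 0 < t ∧ ∀ w : tangent (l p),
      G.g (Φ t p) (l p) w w ≤ G.g p (l p) w w / 2) :
    ∃ a b : ℝ, 0 < a ∧ 0 < b ∧ ∀ (p : M) (t : ℝ), 0 ≤ t → ∀ w : tangent (l p),
      a * Real.exp (b * t) * G.g (Φ t p) (l p) w w ≤ G.g p (l p) w w := by
  obtain ⟨K, hK, hKS⟩ := G.exists_isCompact_along hΦ hl hdom
  have hpos := G.along_pos hl hdom
  have hcont := G.continuous_along hl hdom
  have hz : ∀ e : UnitTangent l, G.along Φ e 0 = G.g e.1.1 (l e.1.1) ⟨_, e.2.1⟩ ⟨_, e.2.1⟩ :=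
    fun e => G.g_congr (Φ.map_zero_apply _) rfl rfl rfl
  obtain ⟨a, b, ha, hb, hab⟩ := exists_exp_le_cocycle
    (fun s (e : UnitTangent l) => (⟨(Φ s e.1.1, e.1.2), by
      rw [hl.flow_invariant]; exact e.2⟩ : UnitTangent l))
    (fun e t => G.along Φ e 0 / G.along Φ e t)
    ((hcont.comp (continuous_fst.prodMk continuous_const)).div hcont fun z => (hpos z.1 z.2).ne')
    (fun e t => div_pos (hpos e 0) (hpos e t))
    (fun e s t => by
      simp only [G.along_flow hl, add_zero]
      have := (hpos e s).ne'
      have := (hpos e (s + t)).ne'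
      field_simp) hK
    (fun e => by
      obtain ⟨e', he', r, hr, h⟩ := hKS e
      exact ⟨e', he', fun t => by rw [h, h, mul_div_mul_left _ _ hr.ne']⟩)
    (fun e => by
      obtain ⟨t, ht, h⟩ := h e.1.1
      refine ⟨t, ht, ?_⟩
      rw [le_div_iff₀ (hpos e t), hz, ← le_div_iff₀' two_pos]
      exact h _)
  refine ⟨a, b, ha, hb, fun p t ht w => ?_⟩
  rcases eq_or_ne w 0 with rfl | hw
  · simp
  · have hw : w.1 ≠ 0 := fun h => hw (Subtype.ext h)
    have h1 := hab (unitTangentMk p w hw) t ht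
    have hr : 0 < (‖w.1‖⁻¹) ^ 2 := pow_pos (inv_pos.2 (norm_pos_iff.2 hw)) 2
    rw [le_div_iff₀ (hpos _ _), G.along_mk, G.along_mk, Φ.map_zero_apply, mul_left_comm] at h1
    exact le_of_mul_le_mul_left h1 hr

/-! ### Transversality of the two sections -/

/-- Over a compact set, a metric family is comparable with the Euclidean metric. -/
theorem MetricFamily.exists_bounds (G : MetricFamily (M := M) ρ)
    (hl : IsParallelSection Φ ρ l) (hdom : ∀ p, (p, l p) ∈ G.dom) {K : Set M} (hK : IsCompact K) :
    ∃ c C : ℝ, 0 < c ∧ 0 < C ∧ ∀ p ∈ K, ∀ w : tangent (l p),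
      c * ‖w.1‖ ^ 2 ≤ G.g p (l p) w w ∧ G.g p (l p) w w ≤ C * ‖w.1‖ ^ 2 := by
  have hcont : Continuous fun e : UnitTangent l => G.along Φ e 0 :=
    (G.continuous_along hl hdom).comp (Continuous.prodMk_left 0)
  have hKc := isCompact_unitTangent hl.continuous hK
  obtain ⟨c, hc, hcK⟩ := hKc.exists_forall_le' hcont.continuousOn (a := 0)
    fun e _ => G.along_pos hl hdom e 0
  obtain ⟨C, hC⟩ := hKc.bddAbove_image hcont.continuousOn
  refine ⟨c, max C 1, hc, lt_max_of_lt_right one_pos, fun p hp w => ?_⟩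
  rcases eq_or_ne w 0 with rfl | hw
  · simp
  · have hw : w.1 ≠ 0 := fun h => hw (Subtype.ext h)
    have hn : 0 < ‖w.1‖ ^ 2 := pow_pos (norm_pos_iff.2 hw) 2
    have h1 := hcK (unitTangentMk p w hw) hp
    have h2 := hC (Set.mem_image_of_mem _ (show unitTangentMk p w hw ∈ _ from hp))
    rw [G.along_mk, Φ.map_zero_apply, inv_pow] at h1 h2
    rw [le_inv_mul_iff₀ hn, mul_comm] at h1
    rw [inv_mul_le_iff₀ hn, mul_comm] at h2
    exact ⟨h1, h2.trans (mul_le_mul_of_nonneg_right (le_max_left _ _) hn.le)⟩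

/-- By equivariance the metric at `q` is that at `γ • q` evaluated on images, so Euclidean bounds at
`γ • q` become bounds on the differential. -/
theorem MetricFamily.bounds_dAct (G : MetricFamily (M := M) ρ) (hl : IsParallelSection Φ ρ l)
    (hdom : ∀ p, (p, l p) ∈ G.dom) {c C : ℝ} {γ : Γ} {q : M}
    (h : ∀ w : tangent (l (γ • q)), c * ‖w.1‖ ^ 2 ≤ G.g (γ • q) (l (γ • q)) w w ∧
      G.g (γ • q) (l (γ • q)) w w ≤ C * ‖w.1‖ ^ 2) {x : Ein n} (hx : l q = x) (w : tangent x) :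
    c * ‖(dAct (ρ γ : O2 n) x w).1‖ ^ 2 ≤ G.g q x w w ∧
      G.g q x w w ≤ C * ‖(dAct (ρ γ : O2 n) x w).1‖ ^ 2 := by
  subst hx
  have hmem : (dAct (ρ γ : O2 n) (l q) w).1 ∈ tangent (l (γ • q)) := by
    rw [hl.equivariant]
    exact (dAct (ρ γ : O2 n) (l q) w).2
  have h1 := h ⟨_, hmem⟩
  rwa [G.g_smul γ (hdom q) (hl.equivariant γ q)] at h1

theorem sca_ne_zero_of_exp [LocallyCompactSpace M] [ContinuousConstSMul Γ M]
    [CompactSpace (MulAction.orbitRel.Quotient Γ M)] {lp lm : M → Ein n}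
    (hlp : IsParallelSection Φ ρ lp) (hlm : IsParallelSection Φ ρ lm)
    (gp gm : MetricFamily (M := M) ρ)
    (hgp : ∀ p, (p, lp p) ∈ gp.dom) (hgm : ∀ p, (p, lm p) ∈ gm.dom) {a b : ℝ} (ha : 0 < a)
    (hb : 0 < b)
    (hp : ∀ (p : M) (t : ℝ), 0 ≤ t → ∀ w : tangent (lp p),
      a * Real.exp (b * t) * gp.g p (lp p) w w ≤ gp.g (Φ t p) (lp p) w w)
    (hm : ∀ (p : M) (t : ℝ), 0 ≤ t → ∀ w : tangent (lm p),
      a * Real.exp (b * t) * gm.g (Φ t p) (lm p) w w ≤ gm.g p (lm p) w w) (p : M) :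
    sca (lp p).1 (lm p).1 ≠ 0 := by
  obtain ⟨K₀, hK₀, hKM⟩ := exists_isCompact_smul_mem Γ M
  -- Adding `p` makes the same constants valid at both ends: before the flow at `p`, and after it at
  -- `γ • Φ t p`.
  have hK : IsCompact (insert p K₀) := hK₀.insert p
  obtain ⟨c₁, C₁, hc₁, hC₁, h₁⟩ := gp.exists_bounds hlp hgp hK
  obtain ⟨c₂, C₂, hc₂, hC₂, h₂⟩ := gm.exists_bounds hlm hgm hK
  -- The threshold is what `C₂ / (a * E * c₂) < a * c₁ / C₁` requires; `E ≥ 1` then bounds the right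
  -- side by the squared expansion factor.
  obtain ⟨t, htX, ht⟩ : ∃ t : ℝ, (C₂ / c₂) / (a * (a * c₁ / C₁)) < Real.exp (b * t) ∧ 0 ≤ t := by
    have htop : Filter.Tendsto (fun t : ℝ => Real.exp (b * t)) Filter.atTop Filter.atTop :=
      Real.tendsto_exp_atTop.comp (Filter.tendsto_id.const_mul_atTop hb)
    exact ((htop.eventually_gt_atTop _).and (Filter.eventually_ge_atTop 0)).exists
  obtain ⟨γ, hγ⟩ := hKM (Φ t p)
  have hE : 1 ≤ Real.exp (b * t) := Real.one_le_exp (by positivity)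
  set E := Real.exp (b * t) with hEdef
  have hE0 : 0 < E := one_pos.trans_le hE
  refine sca_ne_zero_of_expands_of_contracts (ρ γ : O2 n) (lp p) (lm p)
    (c := √(C₂ / (a * E * c₂))) (C := √(a * E * c₁ / C₁)) (by positivity) ?_ (fun w => ?_)
    fun w => ?_
  · refine Real.sqrt_lt_sqrt (by positivity) ?_
    rw [div_lt_iff₀ (by positivity)] at htX
    calc C₂ / (a * E * c₂) = (C₂ / c₂) / (a * E) := by field_simp
      _ < a * c₁ / C₁ := by
        rw [div_lt_iff₀ (by positivity)]
        linarith
      _ ≤ a * c₁ / C₁ * E := le_mul_of_one_le_right (by positivity) hE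
      _ = a * E * c₁ / C₁ := by ring
  · have h3 := (gp.bounds_dAct hlp hgp (h₁ _ (Set.mem_insert_of_mem _ hγ))
      (hlp.flow_invariant t p) w).2
    have h4 := mul_le_mul_of_nonneg_left (h₁ p (Set.mem_insert _ _) w).1 (mul_pos ha hE0).le
    exact sqrt_mul_le_of_mul_sq_le (mul_pos ha hE0) hc₁ hC₁ (norm_nonneg _)
      ((h4.trans (hp p t ht w)).trans h3)
  · have h3 := (gm.bounds_dAct hlm hgm (h₂ _ (Set.mem_insert_of_mem _ hγ))
      (hlm.flow_invariant t p) w).1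
    have h4 := mul_le_mul_of_nonneg_left h3 (mul_pos ha hE0).le
    exact le_sqrt_mul_of_mul_sq_le (mul_pos ha hE0) hc₂ hC₂ (norm_nonneg _)
      ((h4.trans (hm p t ht w)).trans (h₂ p (Set.mem_insert _ _) w).2)

end Families

/-! ### Correction of the sign by the antipodal map -/

theorem abs_eq_one_of_sq {r : ℝ} (hr : r ^ 2 = 1) : |r| = 1 :=
  (pow_eq_one_iff_of_nonneg (abs_nonneg r) two_ne_zero).1 ((sq_abs r).trans hr)

/-- The image of a point of `Ein_n` by `1` or by the antipodal map. -/
def Ein.signed {n : ℕ} (r : ℝ) (hr : r ^ 2 = 1) (x : Ein n) : Ein n :=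
  ⟨r • x.1, by
    rw [norm_smul, x.2.1, mul_one, Real.norm_eq_abs]
    exact abs_eq_one_of_sq hr, by
    rw [sca_smul_left, sca_smul_right, x.2.2, mul_zero, mul_zero]⟩

theorem tangent_le_signed {n : ℕ} (r : ℝ) (hr : r ^ 2 = 1) (x : Ein n) :
    tangent x ≤ tangent (x.signed r hr) := fun w hw => by
  refine ⟨?_, ?_⟩
  · change inner ℝ (r • x.1) w = 0
    rw [real_inner_smul_left, hw.1, mul_zero]
  · change sca (r • x.1) w = 0
    rw [sca_smul_left, hw.2, mul_zero]

theorem Ein.signed_signed {n : ℕ} (r : ℝ) (hr : r ^ 2 = 1) (x : Ein n) :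
    (x.signed r hr).signed r hr = x :=
  Subtype.ext (by
    change r • r • x.1 = x.1
    rw [smul_smul, ← pow_two, hr, one_smul])

theorem mem_tangent_of_mem_signed {n : ℕ} {r : ℝ} {hr : r ^ 2 = 1} {x : Ein n} {w : R2 n}
    (hw : w ∈ tangent (x.signed r hr)) : w ∈ tangent x := by
  rw [← Ein.signed_signed r hr x]
  exact tangent_le_signed _ _ _ hw

theorem Ein.smul_signed {n : ℕ} (A : O2 n) (r : ℝ) (hr : r ^ 2 = 1) (x : Ein n) :
    A • x.signed r hr = (A • x).signed r hr :=
  Subtype.ext (by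
    change ‖A.1.1 (r • x.1)‖⁻¹ • A.1.1 (r • x.1) = r • ‖A.1.1 x.1‖⁻¹ • A.1.1 x.1
    rw [map_smul, norm_smul, Real.norm_eq_abs, abs_eq_one_of_sq hr, one_mul, smul_comm])

/-- In `dAct_apply` the base point enters through its norm and through a projection onto its line,
neither of which sees a sign. -/
theorem dAct_signed {n : ℕ} (A : O2 n) (r : ℝ) (hr : r ^ 2 = 1) (x : Ein n) (w : tangent x) :
    (dAct A (x.signed r hr) (Submodule.inclusion (tangent_le_signed r hr x) w)).1 =
      (dAct A x w).1 := by
  rw [dAct_apply, dAct_apply]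
  simp only [Ein.signed, map_smul, norm_smul, Real.norm_eq_abs,
    abs_eq_one_of_sq hr, one_mul, real_inner_smul_left, smul_smul]
  rw [mul_div_assoc, mul_right_comm, ← pow_two, hr, one_mul]
  rfl

section Signed

variable {n : ℕ} {Γ M : Type*} [Group Γ] [MulAction Γ M] [TopologicalSpace M] {ρ : Γ →* SO2 n}

/-- The pullback of a metric family by a continuous invariant choice of `1` or of the antipodal
map. -/
def MetricFamily.signed (G : MetricFamily (M := M) ρ) (ε : M → ℝ) (hε : ∀ p, ε p ^ 2 = 1)
    (hcont : Continuous ε) (hinv : ∀ (γ : Γ) p, ε (γ • p) = ε p) : MetricFamily (M := M) ρ where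
  dom := {z | (z.1, z.2.signed (ε z.1) (hε z.1)) ∈ G.dom}
  smul_mem γ p x h := by
    have h1 := G.smul_mem γ p _ h
    rw [Ein.smul_signed] at h1
    have h2 : (γ • p, ((ρ γ : O2 n) • x).signed (ε (γ • p)) (hε (γ • p))) ∈ G.dom := by
      simpa only [hinv] using h1
    exact h2
  g p x := (G.g p (x.signed (ε p) (hε p))).comp
    (Submodule.inclusion (tangent_le_signed _ _ x)) (Submodule.inclusion (tangent_le_signed _ _ x))
  symm p x h v w := G.symm p _ h _ _
  pos p x h w hw := G.pos p _ h _ fun h0 =>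
    hw ((map_eq_zero_iff _ (Submodule.inclusion_injective _)).1 h0)
  cont := by
    have hv : Continuous fun e : TEin n => e.1 := continuous_subtype_val
    have hf : Continuous fun z : M × TEin n =>
        ((z.1, ⟨(z.2.1.1.signed (ε z.1) (hε z.1), z.2.1.2), tangent_le_signed _ (hε z.1) _ z.2.2⟩) :
          M × TEin n) := by
      refine continuous_fst.prodMk (Continuous.subtype_mk (Continuous.prodMk ?_ ?_) _)
      · refine Continuous.subtype_mk ((hcont.comp continuous_fst).smul ?_) _
        exact continuous_subtype_val.comp (continuous_fst.comp (hv.comp continuous_snd))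
      · exact continuous_snd.comp (hv.comp continuous_snd)
    exact G.cont.comp hf.continuousOn fun z hz => hz
  equivariant γ p x h v w := by
    have hx : ((ρ γ : O2 n) • x).signed (ε (γ • p)) (hε (γ • p)) =
        (ρ γ : O2 n) • x.signed (ε p) (hε p) := by
      rw [Ein.smul_signed]
      simp only [hinv]
    refine (G.g_congr rfl hx ?_ ?_).trans (G.equivariant γ p _ h _ _)
    · exact (dAct_signed _ _ _ _ _).symm
    · exact (dAct_signed _ _ _ _ _).symm

theorem MetricFamily.signed_g (G : MetricFamily (M := M) ρ) (ε : M → ℝ)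
    (hε : ∀ p, ε p ^ 2 = 1) (hcont : Continuous ε) (hinv : ∀ (γ : Γ) p, ε (γ • p) = ε p) (p : M)
    (x : Ein n) (v w : tangent x) :
    (G.signed ε hε hcont hinv).g p x v w = G.g p (x.signed (ε p) (hε p))
      (Submodule.inclusion (tangent_le_signed _ _ x) v)
      (Submodule.inclusion (tangent_le_signed _ _ x) w) := rfl

theorem MetricFamily.signed_g_signed (G : MetricFamily (M := M) ρ) (ε : M → ℝ)
    (hε : ∀ p, ε p ^ 2 = 1) (hcont : Continuous ε) (hinv : ∀ (γ : Γ) p, ε (γ • p) = ε p) {p : M}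
    {r : ℝ} {hr : r ^ 2 = 1} (hp : ε p = r) {x : Ein n} (w : tangent (x.signed r hr))
    (hw : w.1 ∈ tangent x) :
    (G.signed ε hε hcont hinv).g p (x.signed r hr) w w = G.g p x ⟨w.1, hw⟩ ⟨w.1, hw⟩ := by
  subst hp
  rw [MetricFamily.signed_g]
  exact G.g_congr rfl (Ein.signed_signed _ _ x) (Submodule.coe_inclusion _ _) rfl

variable {Φ : Flow ℝ M} {l : M → Ein n}

theorem IsParallelSection.signed (hl : IsParallelSection Φ ρ l) (ε : M → ℝ)
    (hε : ∀ p, ε p ^ 2 = 1) (hcont : Continuous ε) (hinv : ∀ (γ : Γ) p, ε (γ • p) = ε p)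
    (hflow : ∀ t p, ε (Φ t p) = ε p) :
    IsParallelSection Φ ρ fun p => (l p).signed (ε p) (hε p) where
  continuous := Continuous.subtype_mk
    (hcont.smul (continuous_subtype_val.comp hl.continuous)) _
  equivariant γ p := by
    rw [Ein.smul_signed]
    simp only [hinv, hl.equivariant]
  flow_invariant t p := by
    simp only [hflow, hl.flow_invariant]

end Signed

end EinAnosov

end

/-! ### The proposition -/

theorem mainTheorem6 {n : ℕ} {Γ M : Type*} [Group Γ]
    [TopologicalSpace M] [T2Space M] [LocallyCompactSpace M]
    [MulAction Γ M] [ContinuousConstSMul Γ M] [ProperlyDiscontinuousSMul Γ M]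
    [CompactSpace (MulAction.orbitRel.Quotient Γ M)]
    (Φ : Flow ℝ M) (hΦ : ∀ (t : ℝ) (γ : Γ) (p : M), Φ t (γ • p) = γ • Φ t p)
    (ρ : Γ →* EinAnosov.SO2 n)
    (lp lm : M → EinAnosov.Ein n)
    (hlp : EinAnosov.IsParallelSection Φ ρ lp) (hlm : EinAnosov.IsParallelSection Φ ρ lm)
    (gp gm : EinAnosov.MetricFamily (M := M) ρ)
    (hgp : ∀ p : M, {x | (p, x) ∈ gp.dom} ∈ 𝓝 (lp p))
    (hgm : ∀ p : M, {x | (p, x) ∈ gm.dom} ∈ 𝓝 (lm p))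
    (hexp : ∀ p : M, ∃ t : ℝ, 0 < t ∧ ∀ w : EinAnosov.tangent (lp p),
      2 * gp.g p (lp p) w w ≤ gp.g (Φ t p) (lp p) w w)
    (hcontr : ∀ p : M, ∃ t : ℝ, 0 < t ∧ ∀ w : EinAnosov.tangent (lm p),
      gm.g (Φ t p) (lm p) w w ≤ gm.g p (lm p) w w / 2) :
    EinAnosov.IsAnosov Φ ρ := by
  have hgp' : ∀ p, (p, lp p) ∈ gp.dom := fun p =>
    mem_of_mem_nhds (s := {x | (p, x) ∈ gp.dom}) (hgp p)
  have hgm' : ∀ p, (p, lm p) ∈ gm.dom := fun p =>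
    mem_of_mem_nhds (s := {x | (p, x) ∈ gm.dom}) (hgm p)
  obtain ⟨a₁, b₁, ha₁, hb₁, h₁⟩ := gp.exists_exp_le hΦ hlp hgp' hexp
  obtain ⟨a₂, b₂, ha₂, hb₂, h₂⟩ := gm.exists_le_exp hΦ hlm hgm' hcontr
  obtain ⟨a, b, ha, hb, hp, hm⟩ : ∃ a b : ℝ, 0 < a ∧ 0 < b ∧
      (∀ (p : M) (t : ℝ), 0 ≤ t → ∀ w : EinAnosov.tangent (lp p),
        a * Real.exp (b * t) * gp.g p (lp p) w w ≤ gp.g (Φ t p) (lp p) w w) ∧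
      (∀ (p : M) (t : ℝ), 0 ≤ t → ∀ w : EinAnosov.tangent (lm p),
        a * Real.exp (b * t) * gm.g (Φ t p) (lm p) w w ≤ gm.g p (lm p) w w) := by
    refine ⟨min a₁ a₂, min b₁ b₂, lt_min ha₁ ha₂, lt_min hb₁ hb₂, fun p t ht w => ?_,
      fun p t ht w => ?_⟩
    · exact EinAnosov.mul_exp_mul_le_of_le (min_le_left _ _) (min_le_left _ _) ha₁.le ht
        (gp.g_self_nonneg (hgp' p) w) (h₁ p t ht w)
    · have h := hgm' (Φ t p)
      rw [hlm.flow_invariant] at h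
      exact EinAnosov.mul_exp_mul_le_of_le (min_le_right _ _) (min_le_right _ _) ha₂.le ht
        (gm.g_self_nonneg h w) (h₂ p t ht w)
  have hne := EinAnosov.sca_ne_zero_of_exp hlp hlm gp gm hgp' hgm' ha hb hp hm
  set s : M → ℝ := fun p => EinAnosov.sca (lp p).1 (lm p).1 with hs
  have hscont : Continuous s := EinAnosov.continuous_sca.comp
    ((continuous_subtype_val.comp hlp.continuous).prodMk
      (continuous_subtype_val.comp hlm.continuous))
  have habs : ∀ p, 0 < |s p| := fun p => abs_pos.2 (hne p)
  -- The sign is minus that of `s`, as a function of `p`, since `M` may be disconnected; dividing by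
  -- `|s|` makes its continuity immediate.
  have hε : ∀ p, (-(s p / |s p|)) ^ 2 = 1 := fun p => by
    rw [neg_sq, div_pow, sq_abs, div_self (pow_ne_zero 2 (hne p))]
  have hεcont : Continuous fun p => -(s p / |s p|) :=
    (hscont.div hscont.abs fun p => (habs p).ne').neg
  -- `ρ γ` preserves `sca`, and renormalising the two rays multiplies `s` by a positive number.
  have hεinv : ∀ (γ : Γ) (p : M), -(s (γ • p) / |s (γ • p)|) = -(s p / |s p|) := fun γ p => by
    have h : s (γ • p) = (‖(ρ γ : EinAnosov.O2 n).1.1 (lp p).1‖⁻¹ *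
        ‖(ρ γ : EinAnosov.O2 n).1.1 (lm p).1‖⁻¹) * s p := by
      simp only [hs]
      rw [hlp.equivariant, hlm.equivariant, EinAnosov.coe_smul_ein, EinAnosov.coe_smul_ein,
        EinAnosov.sca_smul_left, EinAnosov.sca_smul_right, (ρ γ : EinAnosov.O2 n).2, mul_assoc]
    have hr := mul_pos (inv_pos.2 (EinAnosov.norm_apply_pos (ρ γ : EinAnosov.O2 n) (lp p)))
      (inv_pos.2 (EinAnosov.norm_apply_pos (ρ γ : EinAnosov.O2 n) (lm p)))
    rw [h, abs_mul, abs_of_pos hr, mul_div_mul_left _ _ hr.ne']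
  have hεflow : ∀ (t : ℝ) (p : M), -(s (Φ t p) / |s (Φ t p)|) = -(s p / |s p|) := fun t p => by
    simp only [hs, hlp.flow_invariant, hlm.flow_invariant]
  refine ⟨lp, fun p => (lm p).signed _ (hε p), hlp,
    hlm.signed _ hε hεcont hεinv hεflow, fun p => ?_, gp, gm.signed _ hε hεcont hεinv, hgp',
    fun p => ?_, a, b, ha, hb, fun p t ht => ⟨hp p t ht, fun w => ?_⟩⟩
  · change EinAnosov.sca (lp p).1 ((-(s p / |s p|)) • (lm p).1) < 0
    rw [EinAnosov.sca_smul_right]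
    change -(s p / |s p|) * s p < 0
    rw [neg_mul, div_mul_eq_mul_div, neg_lt_zero]
    exact div_pos (mul_self_pos.2 (hne p)) (habs p)
  · change (p, ((lm p).signed _ (hε p)).signed _ (hε p)) ∈ gm.dom
    rw [EinAnosov.Ein.signed_signed]
    exact hgm' p
  · have hw := EinAnosov.mem_tangent_of_mem_signed w.2
    have h0 := gm.signed_g_signed _ hε hεcont hεinv rfl w hw
    have ht' := gm.signed_g_signed _ hε hεcont hεinv (hεflow t p) w hw
    rw [h0, ht']
    exact EinAnosov.le_inv_mul_exp_neg_mul ha (hm p t ht ⟨w.1, hw⟩)
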